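/- Let $d \ge 0$, let $P \subset \mathbb{R}^d$ be a set of $n$ points and let $q \in \mathbb{R}^d \setminus P$ be such that $P \cup \{q\}$ is in general position, i.e. any at most $d+1$ points of $P \cup \{q\}$ are affinely independent. Let $\Delta_P(q)$ be the set of all $(d+1)$-element subsets of $P$ whose convex hull contains $q$. The simplicial graph $G_P(q)$ is the graph with vertex set $\Delta_P(q)$ in which $\Delta$ and $\Delta'$ are adjacent if and only if $\Delta' = (\Delta \setminus \{v\}) \cup \{p\}$ for some $v \in \Delta$ and some $p \in P \setminus \Delta$. Then $G_P(q)$ is $(n-d-1)$-regular and, if $\Delta_P(q) \neq \emptyset$, it is $(n-d-1)$-connected. Here a graph is called $k$-connected if it has more than $k$ vertices and remains connected after the deletion of any set of fewer than $k$ vertices. -/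

import Mathlib

namespace SimplicialDepth

/-- A set of points in `ℝ^d` is in general position if any at most `d + 1` of its points are
affinely independent. -/
def InGeneralPosition {d : ℕ} (A : Set (EuclideanSpace ℝ (Fin d))) : Prop :=
  ∀ s : Finset (EuclideanSpace ℝ (Fin d)), (s : Set (EuclideanSpace ℝ (Fin d))) ⊆ A →
    s.card ≤ d + 1 → AffineIndependent ℝ (fun x : s => (x : EuclideanSpace ℝ (Fin d)))

open Classical in
/-- `Δ_P(q)`: the `(d + 1)`-element subsets of `P` that contain `q` in their convex hull. -/
noncomputable def simplices {d : ℕ} (P : Finset (EuclideanSpace ℝ (Fin d)))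
    (q : EuclideanSpace ℝ (Fin d)) : Finset (Finset (EuclideanSpace ℝ (Fin d))) :=
  (P.powersetCard (d + 1)).filter
    (fun S => q ∈ convexHull ℝ (S : Set (EuclideanSpace ℝ (Fin d))))

open Classical in
/-- The simplicial graph `G_P(q)`: its nodes are the elements of `Δ_P(q)`, and two nodes are
adjacent iff the second arises from the first by swapping one of its points `v` with a
point `p` of `P` that does not belong to it. -/
def simplicialGraph {d : ℕ} (P : Finset (EuclideanSpace ℝ (Fin d)))
    (q : EuclideanSpace ℝ (Fin d)) : SimpleGraph (simplices P q) where
  Adj S T := ∃ v ∈ S.1, ∃ p ∈ P, p ∉ S.1 ∧ T.1 = insert p (S.1.erase v)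
  symm := ⟨by
    rintro ⟨S, hS⟩ ⟨T, hT⟩ ⟨v, hv, p, hp, hpS, rfl⟩
    have hSP : S ⊆ P := (Finset.mem_powersetCard.1 (Finset.mem_filter.1 hS).1).1
    have hvp : v ≠ p := fun h => hpS (h ▸ hv)
    refine ⟨p, Finset.mem_insert_self _ _, v, hSP hv, ?_, ?_⟩
    · simp [hvp]
    · have h : p ∉ S.erase v := fun h => hpS (Finset.mem_of_mem_erase h)
      simp only [Finset.erase_insert h, Finset.insert_erase hv]⟩
  loopless := ⟨by
    rintro ⟨S, hS⟩ ⟨v, hv, p, hp, hpS, h⟩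
    exact hpS ((Finset.ext_iff.1 h p).2 (Finset.mem_insert_self _ _))⟩

/-- A graph is `k`-(vertex-)connected if it has more than `k` vertices and it stays connected
after the deletion of any fewer than `k` vertices. -/
def IsVertexConnected {V : Type*} (G : SimpleGraph V) (k : ℕ) : Prop :=
  (k : ℕ∞) < ENat.card V ∧ ∀ X : Set V, X.encard < (k : ℕ∞) → (G.induce Xᶜ).Connected

end SimplicialDepth

/-!
The simplicial graph is the graph of a polytope, and its connectivity is Balinski's theorem for
that polytope. Consider the polytope `M` of all weights `w ≥ 0` on `P` with `∑ w x = 1` and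
`∑ w x • x = q`. By general position a point of `M` supported in `d + 1` points of `P` is positive
on all of them (`isWeight_of_nonneg`), so the simplices containing `q` are exactly the supports of
the vertices of `M`, and `M` is simple. At a vertex with support `S` there is one edge for each
`p ∈ P \ S`. The ratio test of the simplex method gives the vertex at its other end
(`exists_pivot`), which is the only simplex `insert p (S.erase v)` containing `q`
(`pivot_unique`). Hence every degree is `|P| - d - 1`.

For connectivity, delete a set `X` of fewer than `|P| - d - 1` vertices and let `V` be a vertex that
remains. As `M` has dimension `|P| - d - 1`, some linear functional vanishes on `X` and at `V` but
not at all vertices (`exists_objective_eq_zero`). A vertex that does not maximize a linear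
functional on `M` has a neighbour with a larger value (`exists_adj_objective_lt`), so from every remaining
vertex with nonnegative value one can climb, avoiding `X`, to a maximum. A small perturbation of the
functional makes this end point the same for all of them
(`exists_forall_reachable_of_objective_nonneg`). The vertices with nonpositive value are treated
in the same way, and `V`, where the functional vanishes, belongs to both parts.
-/

namespace SimplicialDepth

open Finset

variable {d : ℕ} {P S T : Finset (EuclideanSpace ℝ (Fin d))} {q p : EuclideanSpace ℝ (Fin d)}
  {w z : EuclideanSpace ℝ (Fin d) → ℝ}

/-! ### Weights and affine relations -/

/-- `z` is the coefficient function of an affine dependence among the points of `P`: a vector in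
the direction space of the polytope of weights. -/
structure IsAffineRelation (P : Finset (EuclideanSpace ℝ (Fin d)))
    (z : EuclideanSpace ℝ (Fin d) → ℝ) : Prop where
  sum_eq : ∑ x ∈ P, z x = 0
  moment_eq : ∑ x ∈ P, z x • x = 0

/-- `w` represents `q` as a convex combination of points of `P` with support exactly `S`. -/
structure IsWeight (P : Finset (EuclideanSpace ℝ (Fin d))) (q : EuclideanSpace ℝ (Fin d))
    (S : Finset (EuclideanSpace ℝ (Fin d))) (w : EuclideanSpace ℝ (Fin d) → ℝ) : Prop where
  pos : ∀ x ∈ S, 0 < w x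
  eq_zero : ∀ x ∉ S, w x = 0
  sum_eq : ∑ x ∈ P, w x = 1
  moment_eq : ∑ x ∈ P, w x • x = q

/-- `z` is the edge direction at `S` that brings `p` into the support. -/
structure IsEdgeDirection (P S : Finset (EuclideanSpace ℝ (Fin d)))
    (p : EuclideanSpace ℝ (Fin d)) (z : EuclideanSpace ℝ (Fin d) → ℝ) : Prop
    extends IsAffineRelation P z where
  apply_self : z p = 1
  eq_zero : ∀ x ∉ S, x ≠ p → z x = 0

lemma IsWeight.nonneg (h : IsWeight P q S w) (x : EuclideanSpace ℝ (Fin d)) : 0 ≤ w x := by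
  by_cases hx : x ∈ S
  · exact (h.pos x hx).le
  · exact (h.eq_zero x hx).ge

lemma mem_simplices : S ∈ simplices P q ↔
    S ⊆ P ∧ #S = d + 1 ∧ q ∈ convexHull ℝ (S : Set (EuclideanSpace ℝ (Fin d))) := by
  simp [simplices, mem_powersetCard, and_assoc]

lemma InGeneralPosition.eq_zero_of_sum {A : Set (EuclideanSpace ℝ (Fin d))}
    (hA : InGeneralPosition A) (hT : (T : Set (EuclideanSpace ℝ (Fin d))) ⊆ A) (hc : #T ≤ d + 1)
    (h0 : ∑ x ∈ T, z x = 0) (h1 : ∑ x ∈ T, z x • x = 0) : ∀ x ∈ T, z x = 0 := by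
  intro x hx
  refine affineIndependent_iff.1 (hA T hT hc) univ (fun x => z x) ?_ ?_ ⟨x, hx⟩ (mem_univ _)
  · rw [← h0]; exact Finset.sum_coe_sort T z
  · rw [← h1]; exact Finset.sum_coe_sort T (fun x => z x • x)

lemma IsAffineRelation.eq_zero
    (hgen : InGeneralPosition (insert q (P : Set (EuclideanSpace ℝ (Fin d)))))
    (hT : T ⊆ P) (hc : #T ≤ d + 1) (hz : IsAffineRelation P z) (hs : ∀ x ∉ T, z x = 0)
    (x : EuclideanSpace ℝ (Fin d)) : z x = 0 := by
  by_cases hx : x ∈ T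
  · refine hgen.eq_zero_of_sum
      ((Finset.coe_subset.2 hT).trans (Set.subset_insert _ _)) hc ?_ ?_ x hx
    · rw [← hz.sum_eq]
      exact sum_subset hT fun x _ h => hs x h
    · rw [← hz.moment_eq]
      exact sum_subset hT fun x _ h => by simp [hs x h]
  · exact hs x hx

lemma IsAffineRelation.sub_const_mul {z' : EuclideanSpace ℝ (Fin d) → ℝ} (hz : IsAffineRelation P z)
    (hz' : IsAffineRelation P z') (t : ℝ) : IsAffineRelation P (fun x => z x - t * z' x) where
  sum_eq := by simp [sum_sub_distrib, ← mul_sum, hz.sum_eq, hz'.sum_eq]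
  moment_eq := by
    simp [sub_smul, mul_smul, sum_sub_distrib, ← smul_sum, hz.moment_eq, hz'.moment_eq]

lemma isAffineRelation_sum {ι : Type*} (s : Finset ι) (t : ι → ℝ)
    (D : ι → EuclideanSpace ℝ (Fin d) → ℝ) (h : ∀ i ∈ s, IsAffineRelation P (D i)) :
    IsAffineRelation P (fun x => ∑ i ∈ s, t i * D i x) where
  sum_eq := by
    rw [sum_comm]
    exact sum_eq_zero fun i hi => by rw [← mul_sum, (h i hi).sum_eq, mul_zero]
  moment_eq := by
    simp_rw [sum_smul, mul_smul]
    rw [sum_comm]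
    exact sum_eq_zero fun i hi => by rw [← smul_sum, (h i hi).moment_eq, smul_zero]

lemma IsWeight.sub {w' : EuclideanSpace ℝ (Fin d) → ℝ} (h : IsWeight P q S w)
    (h' : IsWeight P q T w') : IsAffineRelation P (fun x => w x - w' x) where
  sum_eq := by simp [sum_sub_distrib, h.sum_eq, h'.sum_eq]
  moment_eq := by simp [sub_smul, sum_sub_distrib, h.moment_eq, h'.moment_eq]

lemma IsWeight.unique {w' : EuclideanSpace ℝ (Fin d) → ℝ}
    (hgen : InGeneralPosition (insert q (P : Set (EuclideanSpace ℝ (Fin d)))))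
    (hS : S ∈ simplices P q) (h : IsWeight P q S w) (h' : IsWeight P q S w') : w = w' := by
  obtain ⟨hSP, hc, -⟩ := mem_simplices.1 hS
  funext x
  have := (h.sub h').eq_zero hgen hSP hc.le
    (fun x hx => by simp [h.eq_zero x hx, h'.eq_zero x hx]) x
  exact sub_eq_zero.1 this

/-- Nondegeneracy: by general position of `q`, a representation of `q` supported in `d + 1` points
of `P` uses all of them. -/
lemma isWeight_of_nonneg (hq : q ∉ P)
    (hgen : InGeneralPosition (insert q (P : Set (EuclideanSpace ℝ (Fin d)))))
    (hSP : S ⊆ P) (hc : #S = d + 1) (hnn : ∀ x ∈ S, 0 ≤ w x) (h0 : ∀ x ∉ S, w x = 0)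
    (hs : ∑ x ∈ P, w x = 1) (hm : ∑ x ∈ P, w x • x = q) : IsWeight P q S w := by
  classical
  refine ⟨fun v hv => lt_of_le_of_ne (hnn v hv) fun hv0 => ?_, h0, hs, hm⟩
  have hqS : q ∉ S.erase v := fun h => hq (hSP (mem_of_mem_erase h))
  have hsub : S.erase v ⊆ P := (erase_subset _ _).trans hSP
  have h0' : ∀ x ∈ P, x ∉ S.erase v → w x = 0 := by
    intro x _ hx
    by_cases hxv : x = v
    · rw [hxv, hv0]
    · exact h0 x fun h => hx (mem_erase.2 ⟨hxv, h⟩)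
  have hne : ∀ x ∈ S.erase v, (if x = q then (-1 : ℝ) else w x) = w x := fun x hx =>
    if_neg fun h : x = q => hqS (h ▸ hx)
  -- Otherwise `w` and the coefficient `-1` at `q` form a dependence among `d + 1` points.
  have := hgen.eq_zero_of_sum (T := insert q (S.erase v))
    (z := fun x => if x = q then -1 else w x) ?_ ?_ ?_ ?_ q (mem_insert_self _ _)
  · simp at this
  · rw [coe_insert]
    exact Set.insert_subset_insert (coe_subset.2 hsub)
  · rw [card_insert_of_notMem hqS, card_erase_of_mem hv, hc]; rfl
  · rw [sum_insert hqS, sum_congr rfl hne, sum_subset hsub h0', hs]; simp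
  · rw [sum_insert hqS, sum_congr rfl fun x hx => by rw [hne x hx],
      sum_subset hsub fun x h h' => by rw [h0' x h h', zero_smul], hm]
    simp

lemma exists_isWeight (hq : q ∉ P)
    (hgen : InGeneralPosition (insert q (P : Set (EuclideanSpace ℝ (Fin d)))))
    (hS : S ∈ simplices P q) : ∃ w, IsWeight P q S w := by
  classical
  obtain ⟨hSP, hc, hconv⟩ := mem_simplices.1 hS
  obtain ⟨w, hw, hs, hm⟩ := Finset.mem_convexHull'.1 hconv
  refine ⟨fun x => if x ∈ S then w x else 0, isWeight_of_nonneg hq hgen hSP hc ?_ ?_ ?_ ?_⟩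
  · intro x hx; simpa [hx] using hw x hx
  · intro x hx; simp [hx]
  · rw [← hs, sum_ite_mem, inter_eq_right.2 hSP]
  · simp only [ite_smul, zero_smul]
    rw [← hm, sum_ite_mem, inter_eq_right.2 hSP]

lemma IsWeight.mem_simplices (h : IsWeight P q S w) (hSP : S ⊆ P) (hc : #S = d + 1) :
    S ∈ simplices P q := by
  refine SimplicialDepth.mem_simplices.2 ⟨hSP, hc, Finset.mem_convexHull'.2
    ⟨w, fun x _ => h.nonneg x, ?_, ?_⟩⟩
  · rw [← h.sum_eq]
    exact sum_subset hSP fun x _ hx => h.eq_zero x hx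
  · rw [← h.moment_eq]
    exact sum_subset hSP fun x _ hx => by rw [h.eq_zero x hx, zero_smul]

/-! ### Pivoting along edge directions -/

lemma exists_isEdgeDirection
    (hgen : InGeneralPosition (insert q (P : Set (EuclideanSpace ℝ (Fin d)))))
    (hSP : S ⊆ P) (hc : #S = d + 1) (hp : p ∈ P) (hpS : p ∉ S) :
    ∃ z, IsEdgeDirection P S p z := by
  classical
  have hi := hgen S ((coe_subset.2 hSP).trans (Set.subset_insert _ _)) hc.le
  have htop := hi.affineSpan_eq_top_iff_card_eq_finrank_add_one.2 (by simp [hc])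
  have hmem : p ∈ affineSpan ℝ (Set.range fun x : S => (x : EuclideanSpace ℝ (Fin d))) := by
    rw [htop]; trivial
  obtain ⟨a, ha, hpa⟩ := eq_affineCombination_of_mem_affineSpan_of_fintype hmem
  rw [affineCombination_eq_linear_combination _ _ _ ha] at hpa
  let b : EuclideanSpace ℝ (Fin d) → ℝ := fun x => if h : x ∈ S then a ⟨x, h⟩ else 0
  have hb : ∀ x : S, b x = a x := fun x => by simp [b]
  have hb0 : ∀ x ∉ S, b x = 0 := fun x hx => by simp [b, hx]
  have hb1 : ∑ x ∈ P, b x = 1 := by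
    rw [← sum_subset hSP fun x _ hx => hb0 x hx, ← ha, ← Finset.sum_coe_sort S b]
    exact sum_congr rfl fun x _ => hb x
  have hb2 : ∑ x ∈ P, b x • x = p := by
    rw [← sum_subset hSP fun x _ hx => by rw [hb0 x hx, zero_smul],
      ← Finset.sum_coe_sort S (fun x => b x • x)]
    conv_rhs => rw [hpa]
    exact sum_congr rfl fun x _ => by rw [hb x]
  refine ⟨fun x => (if x = p then 1 else 0) - b x, ⟨?_, ?_⟩, ?_, ?_⟩
  · simp [sum_sub_distrib, hb1, hp]
  · simp [sub_smul, sum_sub_distrib, hb2, hp]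
  · simp [hb0 p hpS]
  · intro x hx hxp; simp [hb0 x hx, hxp]

open Classical in
/-- The ratio test: from the vertex `S` one moves along an edge direction until a coordinate
vanishes. This reaches a vertex of the polytope because the coordinates of `z` sum to `0` while
`z p = 1`, so some coordinate decreases. -/
lemma exists_pivot (hq : q ∉ P)
    (hgen : InGeneralPosition (insert q (P : Set (EuclideanSpace ℝ (Fin d)))))
    (hSP : S ⊆ P) (hc : #S = d + 1) (hw : IsWeight P q S w) (hp : p ∈ P) (hpS : p ∉ S)
    (hz : IsEdgeDirection P S p z) :
    ∃ v ∈ S, ∃ t > 0, insert p (S.erase v) ∈ simplices P q ∧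
      IsWeight P q (insert p (S.erase v)) (fun x => w x + t * z x) := by
  have hneg : (S.filter fun x => z x < 0).Nonempty := by
    by_contra hne
    have hnn : ∀ x ∈ P, 0 ≤ z x := by
      intro x _
      by_cases hxS : x ∈ S
      · by_contra hlt
        exact hne ⟨x, mem_filter.2 ⟨hxS, not_le.1 hlt⟩⟩
      · by_cases hxp : x = p
        · rw [hxp, hz.apply_self]; exact zero_le_one
        · exact (hz.eq_zero x hxS hxp).ge
    have := (sum_eq_zero_iff_of_nonneg hnn).1 hz.sum_eq p hp
    rw [hz.apply_self] at this
    exact one_ne_zero this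
  obtain ⟨v, hv, hmin⟩ := exists_min_image _ (fun x => w x / (-z x)) hneg
  obtain ⟨hvS, hzv⟩ := mem_filter.1 hv
  have ht : 0 < w v / (-z v) := div_pos (hw.pos v hvS) (neg_pos.2 hzv)
  have hpe : p ∉ S.erase v := fun h => hpS (mem_of_mem_erase h)
  have hTP : insert p (S.erase v) ⊆ P :=
    insert_subset hp ((erase_subset _ _).trans hSP)
  have hTc : #(insert p (S.erase v)) = d + 1 := by
    rw [card_insert_of_notMem hpe, card_erase_of_mem hvS, hc]; rfl
  have hW : IsWeight P q (insert p (S.erase v)) (fun x => w x + w v / (-z v) * z x) := by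
    refine isWeight_of_nonneg hq hgen hTP hTc ?_ ?_ ?_ ?_
    · intro x hx
      rcases mem_insert.1 hx with rfl | hx
      · rw [hz.apply_self, mul_one]
        exact add_nonneg (hw.nonneg _) ht.le
      · have hxS := mem_of_mem_erase hx
        rcases le_or_gt 0 (z x) with h | h
        · exact add_nonneg (hw.nonneg _) (mul_nonneg ht.le h)
        · have := hmin x (mem_filter.2 ⟨hxS, h⟩)
          rw [le_div_iff₀ (neg_pos.2 h)] at this
          linarith
    · intro x hx
      rw [mem_insert, not_or] at hx
      by_cases hxv : x = v
      · rw [hxv]; field_simp [hzv.ne]; ring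
      · have hxS : x ∉ S := fun h => hx.2 (mem_erase.2 ⟨hxv, h⟩)
        rw [hw.eq_zero x hxS, hz.eq_zero x hxS hx.1]; simp
    · rw [sum_add_distrib, ← mul_sum, hz.sum_eq, hw.sum_eq]; simp
    · simp_rw [add_smul, mul_smul]
      rw [sum_add_distrib, ← smul_sum, hz.moment_eq, hw.moment_eq]; simp
  exact ⟨v, hvS, _, ht, hW.mem_simplices hTP hTc, hW⟩

open Classical in
/-- Along the ray from the vertex `S` in an edge direction there is only one vertex, so the point
leaving the support is determined by the entering one. -/
lemma pivot_unique (hq : q ∉ P)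
    (hgen : InGeneralPosition (insert q (P : Set (EuclideanSpace ℝ (Fin d)))))
    (hS : S ∈ simplices P q) (hp : p ∈ P) (hpS : p ∉ S) {v v' : EuclideanSpace ℝ (Fin d)}
    (hv : v ∈ S) (hv' : v' ∈ S) (hT : insert p (S.erase v) ∈ simplices P q)
    (hT' : insert p (S.erase v') ∈ simplices P q) : v = v' := by
  obtain ⟨hSP, hc, -⟩ := mem_simplices.1 hS
  obtain ⟨w, hw⟩ := exists_isWeight hq hgen hS
  obtain ⟨z, hz⟩ := exists_isEdgeDirection hgen hSP hc hp hpS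
  -- The weights of both pivoted simplices lie on the ray from `w` in direction `z`.
  have key : ∀ v ∈ S, insert p (S.erase v) ∈ simplices P q → ∃ t, 0 < t ∧
      IsWeight P q (insert p (S.erase v)) (fun x => w x + t * z x) := by
    intro v hv hT
    obtain ⟨y, hy⟩ := exists_isWeight hq hgen hT
    have := ((hy.sub hw).sub_const_mul hz.toIsAffineRelation (y p)).eq_zero hgen hSP hc.le ?_
    · refine ⟨y p, hy.pos p (mem_insert_self _ _), ?_⟩
      convert hy using 2 with x
      linarith [this x]
    · intro x hx
      by_cases hxp : x = p
      · rw [hxp, hz.apply_self, hw.eq_zero p hpS]; ring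
      · rw [hz.eq_zero x hx hxp, hw.eq_zero x hx, hy.eq_zero x]
        · ring
        · simp [hxp, hx]
  have hnot : ∀ v ∈ S, v ∉ insert p (S.erase v) := by
    intro v hv h
    rcases mem_insert.1 h with rfl | h
    · exact hpS hv
    · exact notMem_erase _ _ h
  obtain ⟨t, ht, hWt⟩ := key v hv hT
  obtain ⟨t', ht', hWt'⟩ := key v' hv' hT'
  by_contra hne
  have e1 := hWt.eq_zero v (hnot v hv)
  have e2 := hWt'.eq_zero v' (hnot v' hv')
  have l1 := hWt.pos v' (mem_insert_of_mem (mem_erase.2 ⟨Ne.symm hne, hv'⟩))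
  have l2 := hWt'.pos v (mem_insert_of_mem (mem_erase.2 ⟨hne, hv⟩))
  have p1 := hw.pos v hv
  have p2 := hw.pos v' hv'
  have n1 : z v < 0 := by
    by_contra h
    nlinarith [mul_nonneg ht.le (not_lt.1 h)]
  have n2 : z v' < 0 := by
    by_contra h
    nlinarith [mul_nonneg ht'.le (not_lt.1 h)]
  -- The larger of the two steps would make a coordinate negative that decreases along the ray.
  rcases le_total t t' with h | h
  · nlinarith [mul_le_mul_of_nonpos_right h n1.le]
  · nlinarith [mul_le_mul_of_nonpos_right h n2.le]

/-! ### Linear functionals on the vertices -/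

open Classical in
/-- The barycentric coordinates of `q` in the simplex `S`: the vertex of the polytope of weights
with support `S`. Where no such weights exist, the value is `0`. -/
noncomputable def weight (P : Finset (EuclideanSpace ℝ (Fin d))) (q : EuclideanSpace ℝ (Fin d))
    (S : Finset (EuclideanSpace ℝ (Fin d))) : EuclideanSpace ℝ (Fin d) → ℝ :=
  if h : ∃ w, IsWeight P q S w then h.choose else 0

lemma isWeight_weight (hq : q ∉ P)
    (hgen : InGeneralPosition (insert q (P : Set (EuclideanSpace ℝ (Fin d)))))
    (S : simplices P q) : IsWeight P q S (weight P q S) := by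
  have h := exists_isWeight hq hgen S.2
  rw [weight, dif_pos h]
  exact h.choose_spec

/-- The linear functional with coefficients `c`, evaluated at the vertex `S` of the polytope of
weights. -/
noncomputable def objective (c : EuclideanSpace ℝ (Fin d) → ℝ) (S : simplices P q) : ℝ :=
  ∑ x ∈ P, c x * weight P q S x

lemma objective_sub (c c' : EuclideanSpace ℝ (Fin d) → ℝ) (S : simplices P q) :
    objective (fun x => c x - c' x) S = objective c S - objective c' S := by
  simp [objective, sub_mul, sum_sub_distrib]

lemma objective_const_mul (t : ℝ) (c : EuclideanSpace ℝ (Fin d) → ℝ) (S : simplices P q) :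
    objective (fun x => t * c x) S = t * objective c S := by
  simp [objective, mul_assoc, mul_sum]

lemma objective_neg (c : EuclideanSpace ℝ (Fin d) → ℝ) (S : simplices P q) :
    objective (-c) S = -objective c S := by
  simp [objective]

/-- Moving from `S` along the edge direction `z` changes every functional in proportion to its
value on `z`. -/
lemma exists_adj_objective (hq : q ∉ P)
    (hgen : InGeneralPosition (insert q (P : Set (EuclideanSpace ℝ (Fin d)))))
    (S : simplices P q) {p : EuclideanSpace ℝ (Fin d)} {z : EuclideanSpace ℝ (Fin d) → ℝ}
    (hp : p ∈ P) (hpS : p ∉ S.1) (hz : IsEdgeDirection P S p z) :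
    ∃ T, (simplicialGraph P q).Adj S T ∧ ∃ t > 0, ∀ c : EuclideanSpace ℝ (Fin d) → ℝ,
      objective c T = objective c S + t * ∑ x ∈ P, c x * z x := by
  obtain ⟨hSP, hc, -⟩ := mem_simplices.1 S.2
  obtain ⟨v, hv, t, ht, hT, hw⟩ :=
    exists_pivot hq hgen hSP hc (isWeight_weight hq hgen S) hp hpS hz
  refine ⟨⟨_, hT⟩, ⟨v, hv, p, hp, hpS, rfl⟩, t, ht, fun c => ?_⟩
  have := (isWeight_weight hq hgen ⟨_, hT⟩).unique hgen hT hw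
  simp only [objective, this, mul_sum, ← sum_add_distrib]
  exact sum_congr rfl fun x _ => by ring

/-- A vertex that is not optimal has a better neighbour: the polytope lies in the cone that the
edge directions at `S` generate. -/
lemma exists_adj_objective_lt (hq : q ∉ P)
    (hgen : InGeneralPosition (insert q (P : Set (EuclideanSpace ℝ (Fin d)))))
    (c : EuclideanSpace ℝ (Fin d) → ℝ) {S T : simplices P q}
    (h : objective c S < objective c T) :
    ∃ S', (simplicialGraph P q).Adj S S' ∧ objective c S < objective c S' := by
  classical
  obtain ⟨hSP, hc, -⟩ := mem_simplices.1 S.2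
  have hwS := isWeight_weight hq hgen S
  have hwT := isWeight_weight hq hgen T
  have hD : ∀ p, ∃ z, p ∈ P \ S.1 → IsEdgeDirection P S p z := by
    intro p
    by_cases hp : p ∈ P \ S.1
    · obtain ⟨hp, hpS⟩ := mem_sdiff.1 hp
      obtain ⟨z, hz⟩ := exists_isEdgeDirection hgen hSP hc hp hpS
      exact ⟨z, fun _ => hz⟩
    · exact ⟨0, fun h => absurd h hp⟩
  choose D hD using hD
  have hTout : ∀ x ∉ P, weight P q T x = 0 := fun x hx =>
    hwT.eq_zero x fun h => hx ((mem_simplices.1 T.2).1 h)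
  -- Both sides agree off `S`, and an affine relation supported in `S` is zero.
  have hdiff : ∀ x, weight P q T x - weight P q S x
      = ∑ p ∈ P \ S.1, weight P q T p * D p x := by
    intro x
    have hrel := (hwT.sub hwS).sub_const_mul (isAffineRelation_sum (P \ S.1) (weight P q T) D
      fun p hp => (hD p hp).toIsAffineRelation) 1
    have := hrel.eq_zero hgen hSP hc.le ?_ x
    · linarith
    · intro y hy
      have : ∑ p ∈ P \ S.1, weight P q T p * D p y = weight P q T y := by
        by_cases hyP : y ∈ P
        · rw [sum_eq_single_of_mem y (mem_sdiff.2 ⟨hyP, hy⟩)]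
          · rw [(hD y (mem_sdiff.2 ⟨hyP, hy⟩)).apply_self, mul_one]
          · intro p hp hne
            rw [(hD p hp).eq_zero y hy hne.symm, mul_zero]
        · rw [hTout y hyP]
          refine sum_eq_zero fun p hp => ?_
          rw [(hD p hp).eq_zero y hy fun h => hyP (h ▸ (mem_sdiff.1 hp).1), mul_zero]
      rw [this, hwS.eq_zero y hy]; ring
  have hsum : objective c T - objective c S
      = ∑ p ∈ P \ S.1, weight P q T p * ∑ x ∈ P, c x * D p x := by
    simp_rw [objective, ← sum_sub_distrib, ← mul_sub, hdiff, mul_sum]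
    rw [sum_comm]
    exact sum_congr rfl fun _ _ => sum_congr rfl fun _ _ => by ring
  obtain ⟨p, hp, hpos⟩ : ∃ p ∈ P \ S.1, 0 < weight P q T p * ∑ x ∈ P, c x * D p x := by
    by_contra! hle
    have := sum_nonpos hle
    linarith
  have hpos' := pos_of_mul_pos_right hpos (hwT.nonneg p)
  obtain ⟨S', hadj, t, ht, hS'⟩ :=
    exists_adj_objective hq hgen S (mem_sdiff.1 hp).1 (mem_sdiff.1 hp).2 (hD p hp)
  exact ⟨S', hadj, by rw [hS' c]; linarith [mul_pos ht hpos']⟩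

/-! ### Regularity -/

/-- The simplices adjacent to `S` correspond to the points of `P` outside `S`: every such point
can be pivoted in, and the point it replaces is determined. -/
lemma card_neighborSet_simplicialGraph (hq : q ∉ P)
    (hgen : InGeneralPosition (insert q (P : Set (EuclideanSpace ℝ (Fin d)))))
    (S : simplices P q) :
    Nat.card ((simplicialGraph P q).neighborSet S) = #P - d - 1 := by
  classical
  obtain ⟨hSP, hc, -⟩ := mem_simplices.1 S.2
  have hex : ∀ p : (P \ S.1 : Finset _), ∃ v ∈ S.1, insert p.1 (S.1.erase v) ∈ simplices P q := by
    intro p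
    obtain ⟨hp, hpS⟩ := mem_sdiff.1 p.2
    obtain ⟨z, hz⟩ := exists_isEdgeDirection hgen hSP hc hp hpS
    obtain ⟨v, hv, -, -, hT, -⟩ :=
      exists_pivot hq hgen hSP hc (isWeight_weight hq hgen S) hp hpS hz
    refine ⟨v, hv, ?_⟩
    convert hT
  choose v hv hT using hex
  let f : (P \ S.1 : Finset _) → (simplicialGraph P q).neighborSet S := fun p =>
    ⟨⟨_, hT p⟩, v p, hv p, p, (mem_sdiff.1 p.2).1, (mem_sdiff.1 p.2).2, by simp⟩
  have hf : Function.Bijective f := by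
    constructor
    · intro p p' h
      have h1 : insert p.1 (S.1.erase (v p)) = insert p'.1 (S.1.erase (v p')) :=
        congrArg (fun T => T.1.1) h
      have h2 : p.1 ∈ insert p'.1 (S.1.erase (v p')) := h1 ▸ mem_insert_self _ _
      rcases mem_insert.1 h2 with h2 | h2
      · exact Subtype.ext h2
      · exact absurd (mem_of_mem_erase h2) (mem_sdiff.1 p.2).2
    · rintro ⟨⟨T, hTm⟩, u, hu, p, hp, hpS, hTe⟩
      have hTe' : T = insert p (S.1.erase u) := hTe
      subst hTe'
      refine ⟨⟨p, mem_sdiff.2 ⟨hp, hpS⟩⟩, Subtype.ext (Subtype.ext ?_)⟩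
      have := pivot_unique hq hgen S.2 hp hpS hu (hv ⟨p, mem_sdiff.2 ⟨hp, hpS⟩⟩)
        hTm (hT ⟨p, mem_sdiff.2 ⟨hp, hpS⟩⟩)
      simp only [f, ← this]
  rw [← Nat.card_eq_of_bijective f hf, Nat.card_eq_fintype_card, Fintype.card_coe,
    card_sdiff_of_subset hSP, hc]
  omega

/-! ### Connectivity after deleting vertices -/

/-- The vertices where the functional `c` is nonnegative stay connected to each other when vertices
with `c ≤ 0` are deleted: all that remain can be joined to one maximizer of `c`. Paths that only
increase `c` could stop at different maximizers; a small perturbation of `c` makes one of them the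
only maximum. -/
lemma exists_forall_reachable_of_objective_nonneg (hq : q ∉ P)
    (hgen : InGeneralPosition (insert q (P : Set (EuclideanSpace ℝ (Fin d)))))
    (c : EuclideanSpace ℝ (Fin d) → ℝ) (X : Set (simplices P q))
    (hX : ∀ S ∈ X, objective c S ≤ 0) (hpos : ∃ S : simplices P q, 0 < objective c S) :
    ∃ W : (Xᶜ : Set (simplices P q)), ∀ S : (Xᶜ : Set (simplices P q)), 0 ≤ objective c S.1 →
      ((simplicialGraph P q).induce Xᶜ).Reachable S W := by
  classical
  obtain ⟨S₀, hS₀⟩ := hpos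
  have : Nonempty (simplices P q) := ⟨S₀⟩
  obtain ⟨W, hW⟩ := Finite.exists_max (fun S : simplices P q => objective c S)
  have hWX : W ∈ Xᶜ := fun h => absurd (hX W h) (not_le.2 (hS₀.trans_le (hW S₀)))
  -- `h` is the total weight outside `W`; it lies in `[0, 1]` and vanishes only at `W`.
  let h : EuclideanSpace ℝ (Fin d) → ℝ := fun x => if x ∈ W.1 then 0 else 1
  have h_nonneg : ∀ S : simplices P q, 0 ≤ objective h S := fun S =>
    sum_nonneg fun x _ => mul_nonneg (by simp only [h]; split_ifs <;> norm_num)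
      ((isWeight_weight hq hgen S).nonneg x)
  have h_le : ∀ S : simplices P q, objective h S ≤ 1 := fun S => by
    rw [← (isWeight_weight hq hgen S).sum_eq]
    refine sum_le_sum fun x _ => mul_le_of_le_one_left ((isWeight_weight hq hgen S).nonneg x) ?_
    simp only [h]; split_ifs <;> norm_num
  have h_W : objective h W = 0 := sum_eq_zero fun x _ => by
    by_cases hx : x ∈ W.1
    · simp [h, hx]
    · rw [(isWeight_weight hq hgen W).eq_zero x hx, mul_zero]
  have h_pos : ∀ S : simplices P q, S ≠ W → 0 < objective h S := fun S hne => by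
    obtain ⟨hSP, hSc, -⟩ := mem_simplices.1 S.2
    obtain ⟨-, hWc, -⟩ := mem_simplices.1 W.2
    obtain ⟨x, hxS, hxW⟩ : ∃ x ∈ S.1, x ∉ W.1 := by
      by_contra! hsub
      exact hne (Subtype.ext (eq_of_subset_of_card_le hsub (by rw [hSc, hWc])))
    refine sum_pos' (fun x _ => mul_nonneg (by simp only [h]; split_ifs <;> norm_num)
      ((isWeight_weight hq hgen S).nonneg x)) ⟨x, hSP hxS, ?_⟩
    simpa [h, hxW] using (isWeight_weight hq hgen S).pos x hxS
  -- `ε` is so small that perturbing `c` by `ε * h` keeps all positive values positive.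
  obtain ⟨ε, hε, hεlt⟩ : ∃ ε > 0, ∀ S : simplices P q, 0 < objective c S → ε < objective c S := by
    obtain ⟨S₁, hS₁⟩ := Finite.exists_min
      (fun S : simplices P q => if 0 < objective c S then objective c S else objective c W)
    have hW0 : 0 < objective c W := hS₀.trans_le (hW S₀)
    have h1 : 0 < if 0 < objective c S₁ then objective c S₁ else objective c W := by
      split_ifs with h' <;> assumption
    refine ⟨_, half_pos h1, fun S hS => (half_lt_self h1).trans_le ?_⟩
    have := hS₁ S
    rwa [if_pos hS] at this
  let g : EuclideanSpace ℝ (Fin d) → ℝ := fun x => c x - ε * h x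
  have hg : ∀ S : simplices P q, objective g S = objective c S - ε * objective h S := fun S => by
    rw [objective_sub, objective_const_mul]
  have hgX : ∀ S ∈ X, objective g S ≤ 0 := fun S hS => by
    rw [hg]; linarith [hX S hS, mul_nonneg hε.le (h_nonneg S)]
  have hgW : ∀ S : simplices P q, S ≠ W → objective g S < objective g W := fun S hne => by
    rw [hg, hg, h_W]; linarith [hW S, mul_pos hε (h_pos S hne)]
  have hgpos : ∀ S : simplices P q, 0 < objective c S → 0 < objective g S := fun S hS => by
    rw [hg]; nlinarith [hεlt S hS, h_le S]
  have climb : ∀ (S : simplices P q) (hS : S ∈ Xᶜ), 0 < objective g S →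
      ((simplicialGraph P q).induce Xᶜ).Reachable ⟨S, hS⟩ ⟨W, hWX⟩ := by
    intro S
    induction S using (Finite.wellFounded_of_trans_of_irrefl
      (InvImage (· > ·) fun S : simplices P q => objective g S)).induction with
    | h S ih =>
      intro hS hpos
      by_cases hSW : S = W
      · subst hSW; exact SimpleGraph.Reachable.refl _
      · obtain ⟨S', hadj, hlt⟩ := exists_adj_objective_lt hq hgen g (hgW S hSW)
        have hS' : S' ∈ Xᶜ := fun hx => absurd (hgX S' hx) (not_le.2 (hpos.trans hlt))
        have hadj' : ((simplicialGraph P q).induce Xᶜ).Adj ⟨S, hS⟩ ⟨S', hS'⟩ := hadj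
        exact hadj'.reachable.trans (ih S' hlt hS' (hpos.trans hlt))
  refine ⟨⟨W, hWX⟩, fun S hS => ?_⟩
  -- A vertex at level `0` first takes one step that increases `c` itself.
  rcases hS.lt_or_eq with hS | hS
  · exact climb S.1 S.2 (hgpos _ hS)
  · obtain ⟨S', hadj, hlt⟩ := exists_adj_objective_lt hq hgen c
      (show objective c S.1 < objective c S₀ by rw [← hS]; exact hS₀)
    rw [← hS] at hlt
    have hS' : S' ∈ Xᶜ := fun hx => absurd (hX S' hx) (not_le.2 hlt)
    have hadj' : ((simplicialGraph P q).induce Xᶜ).Adj S ⟨S', hS'⟩ := hadj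
    exact hadj'.reachable.trans (climb S' hS' (hgpos _ hlt))

/-- Fewer than `|P| - d - 1` vertices and one further vertex `V` lie in a hyperplane that does not
contain all vertices: in the coordinates at `V`, indexed by `P \ V`, such a hyperplane through the
origin is a nonzero solution of fewer than `|P \ V|` homogeneous linear equations. -/
lemma exists_objective_eq_zero (hq : q ∉ P)
    (hgen : InGeneralPosition (insert q (P : Set (EuclideanSpace ℝ (Fin d)))))
    (X : Set (simplices P q)) (hX : X.ncard < #P - d - 1) (V : simplices P q) :
    ∃ c : EuclideanSpace ℝ (Fin d) → ℝ, objective c V = 0 ∧ (∀ S ∈ X, objective c S = 0) ∧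
      ∃ S : simplices P q, objective c S ≠ 0 := by
  classical
  obtain ⟨hVP, hc, -⟩ := mem_simplices.1 V.2
  let N : Finset (EuclideanSpace ℝ (Fin d)) := P \ V.1
  let L : (N → ℝ) →ₗ[ℝ] (X → ℝ) :=
    LinearMap.pi fun S => ∑ p : N, weight P q S.1 p • LinearMap.proj p
  obtain ⟨a, ha, ha0⟩ : ∃ a, L a = 0 ∧ a ≠ 0 := by
    have hker : LinearMap.ker L ≠ ⊥ := by
      refine LinearMap.ker_ne_bot_of_finrank_lt ?_
      rw [Module.finrank_fintype_fun_eq_card, Module.finrank_fintype_fun_eq_card,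
        ← Nat.card_eq_fintype_card, Nat.card_coe_set_eq, Fintype.card_coe,
        card_sdiff_of_subset hVP, hc]
      omega
    obtain ⟨a, ha, ha0⟩ := (Submodule.ne_bot_iff _).1 hker
    exact ⟨a, LinearMap.mem_ker.1 ha, ha0⟩
  let c : EuclideanSpace ℝ (Fin d) → ℝ := fun x => if h : x ∈ N then a ⟨x, h⟩ else 0
  have hcN : ∀ p : N, c p = a p := fun p => by simp [c]
  have hc0 : ∀ x ∉ N, c x = 0 := fun x hx => by simp [c, hx]
  have hcV : ∀ x ∈ V.1, c x = 0 := fun x hx => hc0 x fun h => (mem_sdiff.1 h).2 hx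
  have hV : objective c V = 0 := sum_eq_zero fun x _ => by
    by_cases hx : x ∈ V.1
    · rw [hcV x hx, zero_mul]
    · rw [(isWeight_weight hq hgen V).eq_zero x hx, mul_zero]
  refine ⟨c, hV, ?_, ?_⟩
  · intro S hS
    have := congrFun ha ⟨S, hS⟩
    simp only [L, LinearMap.pi_apply, LinearMap.sum_apply, LinearMap.smul_apply,
      LinearMap.proj_apply, smul_eq_mul, Pi.zero_apply] at this
    rw [objective, ← sum_subset (sdiff_subset : N ⊆ P) fun x _ hx => by rw [hc0 x hx, zero_mul],
      ← Finset.sum_coe_sort N (fun x => c x * weight P q S x), ← this]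
    exact sum_congr rfl fun x _ => by rw [hcN x, mul_comm]
  · obtain ⟨p, hp⟩ := Function.ne_iff.1 ha0
    obtain ⟨hpP, hpV⟩ := mem_sdiff.1 p.2
    obtain ⟨z, hz⟩ := exists_isEdgeDirection hgen hVP hc hpP hpV
    obtain ⟨T, -, t, ht, hT⟩ := exists_adj_objective hq hgen V hpP hpV hz
    refine ⟨T, ?_⟩
    rw [hT c, hV, zero_add, sum_eq_single_of_mem p.1 hpP, hz.apply_self, mul_one, hcN]
    · exact mul_ne_zero ht.ne' hp
    · intro x _ hxp
      by_cases hx : x ∈ V.1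
      · rw [hcV x hx, zero_mul]
      · rw [hz.eq_zero x hx hxp, mul_zero]

/-- A functional vanishing on the deleted vertices and at `V` splits the remaining vertices into
two connected halves, nonnegative and nonpositive, which share `V`. -/
lemma induce_compl_connected (hq : q ∉ P)
    (hgen : InGeneralPosition (insert q (P : Set (EuclideanSpace ℝ (Fin d)))))
    (X : Set (simplices P q)) (hX : X.ncard < #P - d - 1) {V : simplices P q} (hV : V ∉ X) :
    ((simplicialGraph P q).induce Xᶜ).Connected := by
  obtain ⟨c, hcV, hcX, S, hS⟩ := exists_objective_eq_zero hq hgen X hX V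
  wlog hpos : 0 < objective c S generalizing c
  · refine this (-c) ?_ ?_ ?_ ?_
    · rw [objective_neg, hcV, neg_zero]
    · intro T hT; rw [objective_neg, hcX T hT, neg_zero]
    · rw [objective_neg]; exact neg_ne_zero.2 hS
    · rw [objective_neg]; exact neg_pos.2 (lt_of_le_of_ne (not_lt.1 hpos) hS)
  refine (SimpleGraph.connected_iff_exists_forall_reachable _).2 ⟨⟨V, hV⟩, fun T => ?_⟩
  obtain ⟨W, hW⟩ := exists_forall_reachable_of_objective_nonneg hq hgen c X
    (fun T hT => (hcX T hT).le) ⟨S, hpos⟩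
  rcases le_or_gt 0 (objective c T.1) with hT | hT
  · exact (hW ⟨V, hV⟩ hcV.ge).trans (hW T hT).symm
  · obtain ⟨W', hW'⟩ := exists_forall_reachable_of_objective_nonneg hq hgen (-c) X
      (fun T hT => by rw [objective_neg, hcX T hT, neg_zero])
      ⟨T.1, by rw [objective_neg]; exact neg_pos.2 hT⟩
    exact (hW' ⟨V, hV⟩ (by rw [objective_neg, hcV, neg_zero])).trans
      (hW' T (by rw [objective_neg]; exact (neg_pos.2 hT).le)).symm

end SimplicialDepth

theorem mainTheorem8 {d : ℕ} (P : Finset (EuclideanSpace ℝ (Fin d)))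
    (q : EuclideanSpace ℝ (Fin d)) (hq : q ∉ P)
    (hgen : SimplicialDepth.InGeneralPosition
      (insert q (P : Set (EuclideanSpace ℝ (Fin d)))))
    [(SimplicialDepth.simplicialGraph P q).LocallyFinite] :
    (SimplicialDepth.simplicialGraph P q).IsRegularOfDegree (P.card - d - 1) ∧
      ((SimplicialDepth.simplices P q).Nonempty →
        SimplicialDepth.IsVertexConnected (SimplicialDepth.simplicialGraph P q)
          (P.card - d - 1)) := by
  have hreg : (SimplicialDepth.simplicialGraph P q).IsRegularOfDegree (P.card - d - 1) := by
    intro S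
    rw [← SimplicialDepth.card_neighborSet_simplicialGraph hq hgen S, Nat.card_eq_fintype_card,
      SimpleGraph.card_neighborSet_eq_degree]
  refine ⟨hreg, fun ⟨S, hS⟩ => ?_⟩
  have hcard : P.card - d - 1 < Fintype.card (SimplicialDepth.simplices P q) := by
    classical
    rw [← hreg ⟨S, hS⟩]
    convert (SimplicialDepth.simplicialGraph P q).degree_lt_card_verts ⟨S, hS⟩
  refine ⟨?_, fun X hX => ?_⟩
  · rw [ENat.card_eq_coe_fintype_card]
    exact_mod_cast hcard
  · rw [← X.toFinite.cast_ncard_eq, Nat.cast_lt] at hX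
    obtain ⟨V, hV⟩ : ∃ V, V ∉ X := by
      by_contra! hall
      rw [Set.eq_univ_of_forall hall, Set.ncard_univ, Nat.card_eq_fintype_card] at hX
      exact lt_asymm hX hcard
    exact SimplicialDepth.induce_compl_connected hq hgen X hX hV
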